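/- Let $n\in\mathbb N$, $\alpha_1,\alpha_2\in\mathbb R$ with $\alpha_1+\alpha_2\neq 0$, and put $\mu:=\alpha_2-\tfrac12(\alpha_1+\alpha_2)^2$. For $W=[w_0\ \cdots\ w_{m-1}]\in\mathbb R^{2n\times m}$ let $$T(W):=\sum_{i=0}^{m-1}\Big(\alpha_2 w_iw_i^\top+(\alpha_1+\alpha_2)^2\sum_{j=0}^{i-1}w_iw_j^\top\Big).$$ For $T_d\in\mathbb R^{2n\times 2n}$ call $W$ an exploration sequence matrix for $T_d$ if $W\mathbb 1=0$ and $T(W)=T_d$. A singular value decomposition is written $W=U\Sigma V^\top$ with orthogonal $U=[a_1\ b_1\ \cdots\ a_n\ b_n]$, $V$, and with the singular values $\sigma_1,\sigma_2,\dots\ge 0$ (in no prescribed order) on the diagonal of $\Sigma\in\mathbb R^{2n\times m}$; the pair $\sigma_{2\ell-1},\sigma_{2\ell}$ belongs to the left singular vectors $a_\ell,b_\ell$. (1) Let $2\alpha_2-(\alpha_1+\alpha_2)^2=0$, let $T_d$ be skew-symmetric and $r=\operatorname{rk}(T_d)$. Then for arbitrary $\sigma_1,\dots,\sigma_r>0$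 there are $m\ge r+1$ and an exploration sequence matrix $W\in\mathbb R^{2n\times m}$ for $T_d$ with a singular value decomposition $W=U\Sigma V^\top$ whose nonzero singular values are $\sigma_1,\dots,\sigma_r$ (in these positions) and for which $U^\top T_dU=\operatorname{diag}(C_1,\dots,C_n)$ with $C_\ell=\begin{bmatrix}0&-\delta_\ell\\ \delta_\ell&0\end{bmatrix}$, $\delta_1\ge\dots\ge\delta_n\ge 0$. (2) Let $2\alpha_2-(\alpha_1+\alpha_2)^2\neq 0$. (a) Let $T_d$ be normal, let $(2\alpha_2-(\alpha_1+\alpha_2)^2)(T_d+T_d^\top)$ be positive definite, and let the eigenvalues of $T_d$, with multiplicity, be $\gamma_\ell\pm\delta_\ell \mathrm i$, $\ell=1,\dots,n$, with $\gamma_\ell\in\mathbb R$, $\delta_\ell\ge 0$. Let $W\in\mathbb{R}^{2n\times m}$ be any exploration sequence matrix for $T_d$. Then $W$ has a singular value decomposition $W=U\Sigma V^\top$ with $$[a_1\cdots a_n\ b_1\cdots b_n]^\top\, T_d\,[a_1\cdots a_n\ b_1\cdots b_n]=\begin{bmatrix}\operatorname{diag}(\gamma)&-\operatorname{diag}(\delta)\\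 \operatorname{diag}(\delta)&\operatorname{diag}(\gamma)\end{bmatrix},$$ and every singular value decomposition of $W$ with this property satisfies, for $\ell=1,\dots,n$, $$\sigma_{2\ell-1}=\sigma_{2\ell}>0\quad\text{and}\quad\gamma_\ell=\Big(\alpha_2-\tfrac12(\alpha_1+\alpha_2)^2\Big)\sigma_{2\ell-1}^2 .$$ (b) Let $T_d=\begin{bmatrix}\operatorname{diag}(\gamma)&-I\\ I&\operatorname{diag}(\gamma')\end{bmatrix}$ with $\gamma,\gamma'\in\mathbb R^n$ be normal and let $W\in\mathbb{R}^{2n\times m}$ be any exploration sequence matrix for $T_d$. Then $$T_d=\begin{bmatrix}\operatorname{diag}(\gamma)&-I\\ I&\operatorname{diag}(\gamma)\end{bmatrix},$$ $W$ has a singular value decomposition with $a_\ell=e_\ell$, $b_\ell=e_{n+\ell}$ for $\ell=1,\dots,n$, and in every such decomposition $\sigma_{2\ell-1}=\sigma_{2\ell}>0$ and $\gamma_\ell=\big(\alpha_2-\tfrac12(\alpha_1+\alpha_2)^2\big)\sigma_{2\ell-1}^2$ for all $\ell$. (c) Conversely, let $\sigma_{2\ell-1}=\sigma_{2\ell}>0$,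 $\ell=1,\dots,n$, be arbitrary, put $\gamma_\ell=\big(\alpha_2-\tfrac12(\alpha_1+\alpha_2)^2\big)\sigma_{2\ell-1}^2$ and $T_d=\begin{bmatrix}\operatorname{diag}(\gamma)&-I\\ I&\operatorname{diag}(\gamma)\end{bmatrix}$. Then there are $m\ge 2n+1$ and an exploration sequence matrix $W\in\mathbb R^{2n\times m}$ for $T_d$ that has a singular value decomposition with $a_\ell=e_\ell$, $b_\ell=e_{n+\ell}$ and the singular values $\sigma_1,\dots,\sigma_{2n}$. -/

import Mathlib

/-- The matrix `T(W) = ∑ᵢ (α₂ wᵢ wᵢᵀ + (α₁ + α₂)² ∑_{j < i} wᵢ wⱼᵀ)` of an exploration sequence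
matrix `W = [w₀ ⋯ w_{m-1}] ∈ ℝ^{2n × m}`. The `2n` rows are indexed by `Fin n ⊕ Fin n`, matching the
splitting `wᵢ = [uᵢ; vᵢ]`. -/
noncomputable def explorationT (α₁ α₂ : ℝ) {n m : ℕ} (W : Matrix (Fin n ⊕ Fin n) (Fin m) ℝ) :
    Matrix (Fin n ⊕ Fin n) (Fin n ⊕ Fin n) ℝ :=
  ∑ i : Fin m, (α₂ • Matrix.vecMulVec (W.col i) (W.col i) +
    (α₁ + α₂) ^ 2 • ∑ j ∈ Finset.Iio i, Matrix.vecMulVec (W.col i) (W.col j))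

/-- `W` is an exploration sequence matrix for the target `Td`: `W 𝟙 = 0` and `T(W) = Td`. -/
def IsExploration (α₁ α₂ : ℝ) {n m : ℕ} (Td : Matrix (Fin n ⊕ Fin n) (Fin n ⊕ Fin n) ℝ)
    (W : Matrix (Fin n ⊕ Fin n) (Fin m) ℝ) : Prop :=
  W.mulVec (fun _ => 1) = 0 ∧ explorationT α₁ α₂ W = Td

/-- Position (counted from `0`) of the two members of the `ℓ`-th pair of singular values: with `ℓ`
counted from `0`, the pair `(σ_{2ℓ+1}, σ_{2ℓ+2})` of the usual numbering sits at `2ℓ` and `2ℓ+1`. -/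
def pairPos {n : ℕ} : Fin n ⊕ Fin n → ℕ
  | Sum.inl l => 2 * (l : ℕ)
  | Sum.inr l => 2 * (l : ℕ) + 1

/-- The rectangular `2n × m` matrix `Σ` carrying the numbers `σ` on its diagonal; the rows are listed
in the order of `pairPos`. -/
noncomputable def sigmaMatrix {n : ℕ} (m : ℕ) (σ : Fin n ⊕ Fin n → ℝ) :
    Matrix (Fin n ⊕ Fin n) (Fin m) ℝ :=
  Matrix.of fun k j => if (j : ℕ) = pairPos k then σ k else 0

/-- `W = U Σ Vᵀ` is a singular value decomposition of `W`: `U = [a₁ b₁ ⋯ aₙ bₙ]` and `V` are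
orthogonal and `Σ` has the singular values `σ ≥ 0` on its diagonal. Here `Sum.inl l` and `Sum.inr l`
index the left singular vectors `a_l` and `b_l`, and `σ₁ l`, `σ₂ l` are the two singular
values of the `l`-th pair (`σ_{2l-1}`, `σ_{2l}` when `l` is counted from `1`). If `m < 2n`,
the numbers that do not fit on the diagonal are zero. -/
def IsSVD {n m : ℕ} (W : Matrix (Fin n ⊕ Fin n) (Fin m) ℝ)
    (U : Matrix (Fin n ⊕ Fin n) (Fin n ⊕ Fin n) ℝ) (σ₁ σ₂ : Fin n → ℝ)
    (V : Matrix (Fin m) (Fin m) ℝ) : Prop :=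
  U.transpose * U = 1 ∧ V.transpose * V = 1 ∧
  (∀ l, 0 ≤ σ₁ l ∧ 0 ≤ σ₂ l) ∧
  (∀ k, m ≤ pairPos k → Sum.elim σ₁ σ₂ k = 0) ∧
  W = U * sigmaMatrix m (Sum.elim σ₁ σ₂) * V.transpose

/-- The block matrix `[[diag γ, -diag δ], [diag δ, diag γ]]`. Ordering the basis as
`a₁ b₁ ⋯ aₙ bₙ`, it is the block diagonal matrix with the `2 × 2` blocks `[[γ_l, -δ_l], [δ_l, γ_l]]`. -/
def pairBlock {n : ℕ} (γ δ : Fin n → ℝ) : Matrix (Fin n ⊕ Fin n) (Fin n ⊕ Fin n) ℝ :=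
  Matrix.fromBlocks (Matrix.diagonal γ) (-Matrix.diagonal δ) (Matrix.diagonal δ) (Matrix.diagonal γ)

/-! Let `L` be the strictly lower triangular matrix of ones, so that `T(W) = α₂ W Wᵀ + (α₁ + α₂)² W
L Wᵀ`. Since `L + Lᵀ + 1` is the all-ones matrix, `W 𝟙 = 0` forces the symmetric part of `W L Wᵀ` to
be `-½ W Wᵀ`. Hence `Td + Tdᵀ = c W Wᵀ` with `c = 2α₂ - (α₁ + α₂)²` (`IsExploration.add_transpose`).

If `c ≠ 0`, the target thus fixes the Gram matrix `W Wᵀ`. An orthogonal `U` that brings `Td` to the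
form `pairBlock γ δ` diagonalizes the symmetric part with each `2γ_l` occurring twice, so both
singular values of a pair satisfy `σ² = 2γ_l / c` (`IsExploration.isSVD_of_diagonal`). Such a `U`
comes from the real normal form of a normal matrix (`exists_pairBlock_of_normal`), and it is the
left factor of an SVD because an SVD with given `U` only requires that `U` diagonalize `W Wᵀ` and
that `W` have enough columns (`exists_isSVD`).

For existence, the columns of `W` are the edges of a closed polygon, and the skew part of `W L Wᵀ`
records the signed areas of its projections to the coordinate planes. Area and Gram matrix are
independent: a square walked in many small steps has a fixed area but an arbitrarily small Gram
matrix, and back-and-forth steps raise the Gram matrix without adding area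
(`exists_realizes_plane`). Concatenating one such polygon per plane realizes all `σ` and `δ` at once
(`exists_realizes_pairBlock`). When `c = 0` the Gram matrix drops out of `T(W)`, which leaves the
singular values free. -/

open scoped Matrix

/-! ### Ordered sums and their symmetric part -/

/-- The strictly lower triangular matrix of ones. -/
def strictLowerOnes (m : ℕ) : Matrix (Fin m) (Fin m) ℝ :=
  Matrix.of fun i j => if j < i then 1 else 0

/-- There is a matrix with `m` columns, column sum `s`, Gram matrix `G` and ordered sum
`∑_{j < i} wᵢ wⱼᵀ = L`. -/
def Realizes {κ : Type*} (m : ℕ) (s : κ → ℝ) (G L : Matrix κ κ ℝ) : Prop :=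
  ∃ W : Matrix κ (Fin m) ℝ,
    W.mulVec (fun _ => 1) = s ∧ W * W.transpose = G ∧ W * strictLowerOnes m * W.transpose = L

theorem explorationT_eq (α₁ α₂ : ℝ) {n m : ℕ} (W : Matrix (Fin n ⊕ Fin n) (Fin m) ℝ) :
    explorationT α₁ α₂ W =
      α₂ • (W * W.transpose) + (α₁ + α₂) ^ 2 • (W * strictLowerOnes m * W.transpose) := by
  ext a b
  simp only [explorationT, strictLowerOnes, Matrix.sum_apply, Matrix.add_apply, Matrix.smul_apply,
    Matrix.vecMulVec_apply, Matrix.col_apply, Matrix.mul_apply, Matrix.transpose_apply,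
    Matrix.of_apply, smul_eq_mul, Finset.sum_add_distrib, Finset.mul_sum, Finset.sum_mul]
  congr 1
  rw [Finset.sum_comm' (t' := Finset.univ) (s' := fun j => Finset.Ioi j) (by simp)]
  refine Finset.sum_congr rfl fun j _ => ?_
  rw [← Finset.sum_subset (Finset.subset_univ (Finset.Ioi j))]
  · exact Finset.sum_congr rfl fun i hi => by simp [Finset.mem_Ioi.1 hi]
  · intro i _ hi
    simp [Finset.mem_Ioi.not.1 hi]

theorem strictLowerOnes_add_transpose (m : ℕ) :
    strictLowerOnes m + (strictLowerOnes m).transpose + 1 =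
      Matrix.vecMulVec (fun _ => 1) (fun _ => 1) := by
  ext i j
  rcases lt_trichotomy i j with h | h | h
  · simp [strictLowerOnes, Matrix.vecMulVec_apply, h, h.not_gt, h.ne]
  · simp [strictLowerOnes, Matrix.vecMulVec_apply, h]
  · simp [strictLowerOnes, Matrix.vecMulVec_apply, h, h.not_gt, h.ne']

theorem strictLower_add_transpose {κ : Type*} {m : ℕ} (W : Matrix κ (Fin m) ℝ)
    (hW : W.mulVec (fun _ => 1) = 0) :
    W * strictLowerOnes m * W.transpose + (W * strictLowerOnes m * W.transpose).transpose =
      -(W * W.transpose) := by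
  have h := congrArg (fun M => W * M * W.transpose) (strictLowerOnes_add_transpose m)
  simp only [Matrix.mul_add, Matrix.add_mul, Matrix.mul_one, Matrix.mul_vecMulVec, hW,
    Matrix.zero_vecMulVec, Matrix.zero_mul] at h
  rw [Matrix.transpose_mul, Matrix.transpose_mul, Matrix.transpose_transpose, ← Matrix.mul_assoc]
  exact eq_neg_of_add_eq_zero_left h

/-! ### Closed polygons with prescribed Gram matrix and area -/

/-- Every column of the second block comes after every column of the first, which produces the cross
term `s' sᵀ`. It vanishes for closed polygons, whose data therefore simply add. -/
theorem Realizes.append {κ : Type*} {m m' : ℕ} {s s' : κ → ℝ} {G G' L L' : Matrix κ κ ℝ}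
    (h : Realizes m s G L) (h' : Realizes m' s' G' L') :
    Realizes (m + m') (s + s') (G + G') (L + L' + Matrix.vecMulVec s' s) := by
  obtain ⟨W, rfl, rfl, rfl⟩ := h
  obtain ⟨W', rfl, rfl, rfl⟩ := h'
  refine ⟨Matrix.of fun k => Fin.append (W k) (W' k), ?_, ?_, ?_⟩
  · ext k
    simp [Matrix.mulVec, dotProduct, Fin.sum_univ_add]
  · ext k l
    simp [Matrix.mul_apply, Fin.sum_univ_add]
  · ext k l
    have h1 : ∀ (i : Fin m) (j : Fin m'), ¬ (Fin.natAdd m j < Fin.castAdd m' i) := by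
      intro i j; simp [Fin.lt_def]; omega
    have h2 : ∀ (i : Fin m) (j : Fin m'), (Fin.castAdd m' i < Fin.natAdd m j) := by
      intro i j; simp [Fin.lt_def]; omega
    simp only [Matrix.mul_apply, Fin.sum_univ_add, Matrix.add_apply, Matrix.vecMulVec_apply,
      strictLowerOnes, Matrix.of_apply, Matrix.transpose_apply, Fin.append_left, Fin.append_right,
      h1, h2, Matrix.mulVec, dotProduct, Finset.sum_mul, Finset.mul_sum, Finset.sum_add_distrib,
      add_mul]
    have h3 : ∀ i j : Fin m, Fin.castAdd m' i < Fin.castAdd m' j ↔ i < j := fun _ _ => Iff.rfl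
    simp only [h3, Fin.natAdd_lt_natAdd_iff, if_true, if_false, mul_one, mul_zero, zero_mul,
      Finset.sum_const_zero, add_zero]
    ring

theorem realizes_zero {κ : Type*} (m : ℕ) : Realizes m (0 : κ → ℝ) 0 0 :=
  ⟨0, by simp, by simp, by simp⟩

theorem realizes_single {κ : Type*} (e : κ → ℝ) : Realizes 1 e (Matrix.vecMulVec e e) 0 := by
  refine ⟨Matrix.of fun k _ => e k, ?_, ?_, ?_⟩
  · ext; simp [Matrix.mulVec, dotProduct]
  · ext; simp [Matrix.mul_apply, Matrix.vecMulVec_apply]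
  · ext; simp [Matrix.mul_apply, strictLowerOnes]

theorem Realizes.map {κ κ' : Type*} [Fintype κ] {m : ℕ} {s : κ → ℝ} {G L : Matrix κ κ ℝ}
    (h : Realizes m s G L) (M : Matrix κ' κ ℝ) :
    Realizes m (M.mulVec s) (M * G * M.transpose) (M * L * M.transpose) := by
  obtain ⟨W, rfl, rfl, rfl⟩ := h
  refine ⟨M * W, by simp, ?_, ?_⟩ <;> simp [Matrix.transpose_mul, Matrix.mul_assoc]

theorem realizes_replicate {κ : Type*} (e : κ → ℝ) (q : ℕ) :
    Realizes q ((q : ℝ) • e) ((q : ℝ) • Matrix.vecMulVec e e)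
      (((q : ℝ) * (q - 1) / 2) • Matrix.vecMulVec e e) := by
  induction q with
  | zero => simpa using realizes_zero 0
  | succ q ih =>
    convert ih.append (realizes_single e) using 1
    · push_cast; module
    · push_cast; module
    · rw [Matrix.vecMulVec_smul]; push_cast; module

/-- In the plane, the closed polygons with `∑ eᵢ eᵢᵀ = 1` realize every nonnegative area. -/
theorem exists_realizes_plane (ν : ℝ) (hν : 0 ≤ ν) :
    ∃ m, Realizes m (0 : Fin 2 → ℝ) 1 (-(1 / 2 : ℝ) • 1 + ν • !![0, -1; 1, 0]) := by
  -- `q` is the number of steps per side of a square of side `√ν`. The square contributes `2 q a² =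
  -- 2ν / q` to the Gram matrix on each axis, which has to stay below 1.
  obtain ⟨q, hq⟩ := exists_nat_gt (2 * ν)
  have hq0 : (0 : ℝ) < q := by linarith
  have ha : (√ν / q) ^ 2 = ν / q ^ 2 := by rw [div_pow, Real.sq_sqrt hν]
  have hb : √((1 - 2 * ν / q) / 2) ^ 2 = (1 - 2 * ν / q) / 2 := by
    refine Real.sq_sqrt ?_
    have : 2 * ν / q ≤ 1 := (div_le_one hq0).2 hq.le
    linarith
  generalize √ν / q = a at ha
  generalize √((1 - 2 * ν / q) / 2) = b at hb
  -- The square is walked counterclockwise in steps of length `a`. The steps `±b` along each axis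
  -- enclose no area and complete the Gram matrix through `2 q a² + 2 b² = 1`.
  have h := ((((((realizes_replicate ![a, 0] q).append (realizes_replicate ![0, a] q)).append
    (realizes_replicate ![-a, 0] q)).append (realizes_replicate ![0, -a] q)).append
    ((realizes_single ![b, 0]).append (realizes_single ![-b, 0]))).append
    ((realizes_single ![0, b]).append (realizes_single ![0, -b])))
  refine ⟨q + q + q + q + (1 + 1) + (1 + 1), ?_⟩
  convert h using 1
  · ext i; fin_cases i <;> simp
  · ext i j
    fin_cases i <;> fin_cases j <;> simp
    all_goals (try (field_simp at ha hb)); (try nlinarith)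
  · ext i j
    fin_cases i <;> fin_cases j <;> simp
    all_goals (try (field_simp at ha hb)); (try nlinarith)

theorem exists_realizes_sum {κ ι : Type*} (s : Finset ι) (G L : ι → Matrix κ κ ℝ)
    (h : ∀ i, ∃ m, Realizes m (0 : κ → ℝ) (G i) (L i)) :
    ∃ m, Realizes m (0 : κ → ℝ) (∑ i ∈ s, G i) (∑ i ∈ s, L i) := by
  classical
  induction s using Finset.induction_on with
  | empty => exact ⟨0, by simpa using realizes_zero 0⟩
  | insert i s hi ih =>
    obtain ⟨m, hm⟩ := h i
    obtain ⟨m', hm'⟩ := ih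
    refine ⟨m + m', ?_⟩
    rw [Finset.sum_insert hi, Finset.sum_insert hi]
    simpa using hm.append hm'

theorem exists_realizes_pairBlock {n : ℕ} (σ₁ σ₂ δ : Fin n → ℝ) (hσ : ∀ l, 0 ≤ σ₁ l ∧ 0 ≤ σ₂ l)
    (hδ : ∀ l, 0 ≤ δ l) (h : ∀ l, σ₁ l * σ₂ l = 0 → δ l = 0) (N : ℕ) :
    ∃ m, N ≤ m ∧ Realizes m (0 : Fin n ⊕ Fin n → ℝ)
      (Matrix.diagonal fun k => Sum.elim σ₁ σ₂ k ^ 2)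
      (-(1 / 2 : ℝ) • (Matrix.diagonal fun k => Sum.elim σ₁ σ₂ k ^ 2) + pairBlock 0 δ) := by
  -- `M l` maps the plane to the `l`-th pair of coordinates and stretches its axes by `σ₁ l` and `σ₂
  -- l`. Areas are multiplied by `σ₁ l * σ₂ l`, hence the quotient requested from the plane polygon.
  let M : Fin n → Matrix (Fin n ⊕ Fin n) (Fin 2) ℝ := fun l =>
    Matrix.of fun k => Sum.elim (fun i => ![if i = l then σ₁ l else 0, 0])
      (fun i => ![0, if i = l then σ₂ l else 0]) k
  have hM := fun l => (exists_realizes_plane (δ l / (σ₁ l * σ₂ l))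
    (div_nonneg (hδ l) (mul_nonneg (hσ l).1 (hσ l).2))).imp fun _ h => h.map (M l)
  simp only [Matrix.mulVec_zero] at hM
  obtain ⟨m, hm⟩ := exists_realizes_sum Finset.univ _ _ hM
  -- Zero columns change none of the sums and make the number of columns as large as required.
  refine ⟨m + N, Nat.le_add_left _ _, ?_⟩
  -- If the product of the singular values is zero, the quotient is zero by convention, in agreement
  -- with `δ l = 0`.
  have key : ∀ l, δ l / (σ₁ l * σ₂ l) * (σ₁ l * σ₂ l) = δ l := fun l => by
    by_cases h0 : σ₁ l * σ₂ l = 0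
    · simp [h0, h l h0]
    · exact div_mul_cancel₀ _ h0
  convert hm.append (realizes_zero N) using 1
  · simp
  · ext (i | i) (j | j) <;>
      simp [M, Matrix.sum_apply, Matrix.mul_apply, Fin.sum_univ_two, Matrix.diagonal_apply]
    all_goals exact ite_congr rfl (fun h => by rw [h, sq]) fun _ => rfl
  · ext (i | i) (j | j) <;>
      simp [M, pairBlock, Matrix.sum_apply, Matrix.mul_apply, Fin.sum_univ_two,
        Matrix.diagonal_apply, neg_eq_iff_eq_neg]
    all_goals
      by_cases hij : i = j
      · subst hij
        simp only [if_true]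
        first | ring1 | linear_combination key i | linear_combination -key i
      · simp [hij, Ne.symm hij]

/-! ### Singular value decompositions from the Gram matrix -/

theorem exists_orthogonal_extension {κ ι : Type*} [Fintype κ] [DecidableEq κ] [Fintype ι]
    [DecidableEq ι] (hc : Fintype.card κ = Fintype.card ι) (X : Matrix κ ι ℝ) (s : Set ι)
    (h : ∀ i ∈ s, ∀ j ∈ s, (X.transpose * X) i j = if i = j then 1 else 0) :
    ∃ Q : Matrix κ ι ℝ, Q.transpose * Q = 1 ∧ Q * Q.transpose = 1 ∧ ∀ i ∈ s, ∀ k, Q k i = X k i := by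
  let v : ι → EuclideanSpace ℝ κ := fun i => WithLp.toLp 2 fun k => X k i
  have hv : Orthonormal ℝ (s.domRestrict v) := by
    rw [orthonormal_iff_ite]
    rintro ⟨i, hi⟩ ⟨j, hj⟩
    have := h i hi j hj
    simp only [Matrix.mul_apply, Matrix.transpose_apply] at this
    simpa [v, PiLp.inner_apply, mul_comm] using this
  obtain ⟨b, hb⟩ := hv.exists_orthonormalBasis_extension_of_card_eq (by simpa using hc)
  have hQ : (Matrix.of fun k i => b i k : Matrix κ ι ℝ).transpose *
      (Matrix.of fun k i => b i k : Matrix κ ι ℝ) = 1 := by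
    ext i j
    have := orthonormal_iff_ite.1 b.orthonormal i j
    simpa [Matrix.mul_apply, PiLp.inner_apply, Matrix.one_apply, mul_comm] using this
  refine ⟨_, hQ, (Matrix.mul_eq_one_comm_of_card_eq _ _ _ hc.symm).1 hQ, fun i hi k => ?_⟩
  simp [hb i hi, v]

theorem pairPos_injective {n : ℕ} : Function.Injective (pairPos (n := n)) := by
  rintro (i | i) (j | j) h <;> simp only [pairPos] at h
  · congr 1; ext; omega
  · omega
  · omega
  · congr 1; ext; omega

theorem pairPos_lt {n : ℕ} (k : Fin n ⊕ Fin n) : pairPos k < 2 * n := by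
  rcases k with i | i <;> simp only [pairPos] <;> omega

theorem mul_sigmaMatrix_transpose_apply {n m : ℕ} (σ : Fin n ⊕ Fin n → ℝ)
    (h : ∀ k, m ≤ pairPos k → σ k = 0) (A : Matrix (Fin m) (Fin m) ℝ) (k : Fin n ⊕ Fin n)
    (j : Fin m) :
    (sigmaMatrix m σ * A) k j = if hk : pairPos k < m then σ k * A ⟨pairPos k, hk⟩ j else 0 := by
  rw [Matrix.mul_apply]
  split_ifs with hk
  · rw [Finset.sum_eq_single ⟨pairPos k, hk⟩]
    · simp [sigmaMatrix]
    · intro i _ hi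
      have : (i : ℕ) ≠ pairPos k := fun h => hi (Fin.ext h)
      simp [sigmaMatrix, this]
    · simp
  · exact Finset.sum_eq_zero fun i _ => by simp [sigmaMatrix, h k (not_lt.1 hk)]

theorem sigmaMatrix_mul_transpose {n m : ℕ} (σ : Fin n ⊕ Fin n → ℝ)
    (h : ∀ k, m ≤ pairPos k → σ k = 0) :
    sigmaMatrix m σ * (sigmaMatrix m σ).transpose = Matrix.diagonal fun k => σ k ^ 2 := by
  ext k l
  rw [Matrix.mul_apply, Matrix.diagonal_apply]
  by_cases hk : pairPos k < m
  · rw [Finset.sum_eq_single ⟨pairPos k, hk⟩]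
    · simp [sigmaMatrix, pairPos_injective.eq_iff, sq]
      split_ifs with h <;> simp [h]
    · intro i _ hi
      have : (i : ℕ) ≠ pairPos k := fun h => hi (Fin.ext h)
      simp [sigmaMatrix, this]
    · simp
  · simp [sigmaMatrix, h k (not_lt.1 hk)]

theorem IsSVD.gram {n m : ℕ} {W : Matrix (Fin n ⊕ Fin n) (Fin m) ℝ}
    {U : Matrix (Fin n ⊕ Fin n) (Fin n ⊕ Fin n) ℝ} {σ₁ σ₂ : Fin n → ℝ}
    {V : Matrix (Fin m) (Fin m) ℝ} (h : IsSVD W U σ₁ σ₂ V) :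
    W * W.transpose = U * (Matrix.diagonal fun k => Sum.elim σ₁ σ₂ k ^ 2) * U.transpose := by
  obtain ⟨-, hV, -, h0, rfl⟩ := h
  rw [← sigmaMatrix_mul_transpose _ h0]
  simp only [Matrix.transpose_mul, Matrix.transpose_transpose, Matrix.mul_assoc]
  rw [← Matrix.mul_assoc V.transpose V, hV, Matrix.one_mul]

/-- The rows of `Uᵀ W` are pairwise orthogonal with norms `σ k`. Normalizing the nonzero ones gives
orthonormal columns of `V`, and any orthonormal completion supplies the rest. -/
theorem exists_isSVD {n m : ℕ} (W : Matrix (Fin n ⊕ Fin n) (Fin m) ℝ)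
    (U : Matrix (Fin n ⊕ Fin n) (Fin n ⊕ Fin n) ℝ) (σ₁ σ₂ : Fin n → ℝ)
    (hU : U.transpose * U = 1) (hσ : ∀ l, 0 ≤ σ₁ l ∧ 0 ≤ σ₂ l) (hm : 2 * n ≤ m)
    (hG : W * W.transpose = U * (Matrix.diagonal fun k => Sum.elim σ₁ σ₂ k ^ 2) * U.transpose) :
    ∃ V, IsSVD W U σ₁ σ₂ V := by
  have hpos : ∀ k : Fin n ⊕ Fin n, pairPos k < m := fun k => (pairPos_lt k).trans_le hm
  have h0 : ∀ k, m ≤ pairPos k → Sum.elim σ₁ σ₂ k = 0 := fun k hk => absurd (hpos k) hk.not_gt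
  have hU' := mul_eq_one_comm.1 hU
  set σ := Sum.elim σ₁ σ₂ with hσdef
  set B := U.transpose * W with hB
  have hBB : B * B.transpose = Matrix.diagonal fun k => σ k ^ 2 := by
    rw [hB, Matrix.transpose_mul, Matrix.transpose_transpose, Matrix.mul_assoc,
      ← Matrix.mul_assoc W, hG, Matrix.mul_assoc _ U.transpose, hU, Matrix.mul_one,
      ← Matrix.mul_assoc, hU, Matrix.one_mul]
  have hBB' : ∀ k l, ∑ j, B k j * B l j = if k = l then σ k ^ 2 else 0 := fun k l => by
    simpa [Matrix.mul_apply, Matrix.diagonal_apply] using congrFun (congrFun hBB k) l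
  let X : Matrix (Fin m) (Fin m) ℝ :=
    Matrix.of fun j i => ∑ k, if pairPos k = (i : ℕ) then (σ k)⁻¹ * B k j else 0
  have hX : ∀ k j, X j ⟨pairPos k, hpos k⟩ = (σ k)⁻¹ * B k j := fun k j => by
    simp [X, pairPos_injective.eq_iff, -Fintype.sum_sum_type]
  obtain ⟨V, hV, -, hVX⟩ := exists_orthogonal_extension rfl X
    {i | ∃ k, i = ⟨pairPos k, hpos k⟩ ∧ σ k ≠ 0} (by
      rintro _ ⟨k, rfl, hk⟩ _ ⟨l, rfl, hl⟩
      simp only [Matrix.mul_apply, Matrix.transpose_apply, hX, Fin.mk.injEq,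
        pairPos_injective.eq_iff]
      have : ∑ j, (σ k)⁻¹ * B k j * ((σ l)⁻¹ * B l j) =
          (σ k)⁻¹ * (σ l)⁻¹ * ∑ j, B k j * B l j := by
        rw [Finset.mul_sum]; exact Finset.sum_congr rfl fun _ _ => by ring
      rw [this, hBB']
      split_ifs with h
      · subst h; field_simp
      · simp)
  refine ⟨V, hU, hV, hσ, h0, ?_⟩
  have hBV : sigmaMatrix m σ * V.transpose = B := by
    ext k j
    rw [mul_sigmaMatrix_transpose_apply _ h0, dif_pos (hpos k), Matrix.transpose_apply]
    -- For `σ k = 0` the `k`-th row of `Uᵀ W` has norm zero, so the column of `V` at this position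
    -- does not matter.
    by_cases hk : σ k = 0
    · have h1 := hBB' k k
      rw [if_pos rfl, hk] at h1
      have h2 := (Finset.sum_eq_zero_iff_of_nonneg fun j _ => mul_self_nonneg (B k j)).1
        (by simpa using h1) j (Finset.mem_univ j)
      rw [hk, zero_mul, mul_self_eq_zero.1 h2]
    · rw [hVX _ ⟨k, rfl, hk⟩, hX, mul_inv_cancel_left₀ hk]
  rw [Matrix.mul_assoc, hBV, hB, ← Matrix.mul_assoc, hU', Matrix.one_mul]

/-! ### Real normal form of normal matrices -/

/-- The column space of `X` is invariant under `A` and `Aᵀ`, so its orthogonal complement is as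
well. This is the deflation step of both normal forms. -/
theorem exists_blockDiagonal {κ ρ τ : Type*} [Fintype κ] [DecidableEq κ] [Fintype ρ]
    [DecidableEq ρ] [Fintype τ] [DecidableEq τ] (hc : Fintype.card κ = Fintype.card (ρ ⊕ τ))
    (A : Matrix κ κ ℝ) (X : Matrix κ ρ ℝ) (P : Matrix ρ ρ ℝ) (hX : X.transpose * X = 1)
    (hA : A * X = X * P) (hA' : A.transpose * X = X * P.transpose) :
    ∃ (Q : Matrix κ (ρ ⊕ τ) ℝ) (D : Matrix τ τ ℝ), Q.transpose * Q = 1 ∧ Q * Q.transpose = 1 ∧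
      Q.transpose * A * Q = Matrix.fromBlocks P 0 0 D := by
  obtain ⟨Q, hQ, hQ', hQX⟩ := exists_orthogonal_extension hc (Matrix.fromCols X 0)
    (Set.range Sum.inl) (by
      rintro _ ⟨i, rfl⟩ _ ⟨j, rfl⟩
      simpa [Matrix.mul_apply, Matrix.one_apply] using congrFun (congrFun hX i) j)
  obtain ⟨Y, rfl⟩ : ∃ Y, Q = Matrix.fromCols X Y := by
    refine ⟨Q.toCols₂, ?_⟩
    ext k (i | i)
    · simpa using hQX _ ⟨i, rfl⟩ k
    · simp
  refine ⟨_, Y.transpose * A * Y, hQ, hQ', ?_⟩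
  rw [Matrix.transpose_fromCols, Matrix.fromRows_mul_fromCols, ← Matrix.fromBlocks_one,
    Matrix.fromBlocks_inj] at hQ
  obtain ⟨-, hXY, hYX, -⟩ := hQ
  have h12 : X.transpose * A * Y = 0 := by
    have : X.transpose * A = P * X.transpose := by
      simpa [Matrix.transpose_mul] using congrArg Matrix.transpose hA'
    rw [this, Matrix.mul_assoc, hXY, Matrix.mul_zero]
  rw [Matrix.transpose_fromCols, Matrix.fromRows_mul, Matrix.fromRows_mul_fromCols, h12,
    Matrix.mul_assoc, hA, ← Matrix.mul_assoc, hX, Matrix.one_mul, Matrix.mul_assoc _ _ X, hA,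
    ← Matrix.mul_assoc Y.transpose, hYX, Matrix.zero_mul]

theorem charpoly_conj {κ ι : Type*} [Fintype κ] [DecidableEq κ] [Fintype ι] [DecidableEq ι]
    (A : Matrix κ κ ℝ) (Q : Matrix κ ι ℝ) (hc : Fintype.card κ = Fintype.card ι)
    (hQ : Q * Q.transpose = 1) : (Q.transpose * A * Q).charpoly = A.charpoly := by
  have h := Matrix.charpoly_mul_comm_of_le (Q.transpose * A) Q hc.le
  rwa [hc, Nat.sub_self, pow_zero, one_mul, ← Matrix.mul_assoc, hQ, Matrix.one_mul] at h

theorem conj_mul_conj {κ ι : Type*} [Fintype κ] [DecidableEq κ] [Fintype ι]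
    (A B : Matrix κ κ ℝ) (Q : Matrix κ ι ℝ) (hQ : Q * Q.transpose = 1) :
    Q.transpose * A * Q * (Q.transpose * B * Q) = Q.transpose * (A * B) * Q := by
  simp only [Matrix.mul_assoc]
  rw [← Matrix.mul_assoc Q, hQ, Matrix.one_mul]

theorem transpose_conj {κ ι : Type*} [Fintype κ] [Fintype ι]
    (A : Matrix κ κ ℝ) (Q : Matrix κ ι ℝ) :
    (Q.transpose * A * Q).transpose = Q.transpose * A.transpose * Q := by
  simp [Matrix.transpose_mul, Matrix.mul_assoc]

theorem normal_of_conj_fromBlocks {κ ρ τ : Type*} [Fintype κ] [DecidableEq κ] [Fintype ρ] [Fintype τ]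
    {A : Matrix κ κ ℝ} {Q : Matrix κ (ρ ⊕ τ) ℝ} {P : Matrix ρ ρ ℝ} {D : Matrix τ τ ℝ}
    (hQ : Q * Q.transpose = 1) (hA : A * A.transpose = A.transpose * A)
    (h : Q.transpose * A * Q = Matrix.fromBlocks P 0 0 D) :
    D * D.transpose = D.transpose * D := by
  have h1 := conj_mul_conj A A.transpose Q hQ
  rw [hA, ← conj_mul_conj _ _ Q hQ, ← transpose_conj, h, Matrix.fromBlocks_transpose,
    Matrix.fromBlocks_multiply, Matrix.fromBlocks_multiply, Matrix.fromBlocks_inj] at h1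
  simpa using h1.2.2.2

theorem exists_real_eigenvector {κ : Type*} [Fintype κ] [DecidableEq κ] (A : Matrix κ κ ℝ)
    (hA : A * A.transpose = A.transpose * A) (c : ℝ)
    (hc : (Polynomial.X - Polynomial.C c) ∣ A.charpoly) :
    ∃ X : Matrix κ (Fin 1) ℝ, X.transpose * X = 1 ∧ A * X = X * Matrix.diagonal (fun _ : Fin 1 => c) ∧
      A.transpose * X = X * Matrix.diagonal (fun _ : Fin 1 => c) := by
  have hdet : (Matrix.scalar κ c - A).det = 0 := by
    rw [← Matrix.eval_charpoly]; exact Polynomial.dvd_iff_isRoot.1 hc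
  obtain ⟨v, hv, hAv⟩ := Matrix.exists_mulVec_eq_zero_iff.2 hdet
  set N := Matrix.scalar κ c - A with hN
  have hNN : N * N.transpose = N.transpose * N := by
    have : N = c • 1 - A := by rw [hN, Matrix.scalar_apply, Matrix.smul_one_eq_diagonal]
    rw [this]
    simp [Matrix.mul_sub, Matrix.sub_mul, hA, smul_sub]
    abel
  -- A normal matrix satisfies `‖Nᵀ v‖ = ‖N v‖`, so the kernels of `N` and `Nᵀ` agree.
  have hNv : N.transpose.mulVec v = 0 := by
    rw [← dotProduct_self_eq_zero, Matrix.dotProduct_mulVec, Matrix.vecMul_transpose,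
      Matrix.mulVec_mulVec, hNN, ← Matrix.mulVec_mulVec, hAv, Matrix.mulVec_zero, zero_dotProduct]
  have h1 : A.mulVec v = c • v := by
    rw [hN, Matrix.sub_mulVec] at hAv
    simpa [Matrix.scalar_apply, ← Matrix.smul_one_eq_diagonal, Matrix.smul_mulVec, eq_comm]
      using sub_eq_zero.1 hAv
  have h2 : A.transpose.mulVec v = c • v := by
    rw [hN, Matrix.transpose_sub, Matrix.sub_mulVec] at hNv
    simpa [Matrix.scalar_apply, ← Matrix.smul_one_eq_diagonal, Matrix.smul_mulVec, eq_comm]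
      using sub_eq_zero.1 hNv
  have hpos : 0 < v ⬝ᵥ v := by
    refine lt_of_le_of_ne (Finset.sum_nonneg fun i _ => mul_self_nonneg _) fun h => hv ?_
    exact dotProduct_self_eq_zero.1 h.symm
  obtain ⟨t, ht⟩ : ∃ t : ℝ, t * t * (v ⬝ᵥ v) = 1 := ⟨(√(v ⬝ᵥ v))⁻¹, by
    rw [← mul_inv, Real.mul_self_sqrt hpos.le, inv_mul_cancel₀ hpos.ne']⟩
  obtain ⟨X, hX⟩ : ∃ X : Matrix κ (Fin 1) ℝ, ∀ k i, X k i = t * v k :=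
    ⟨Matrix.of fun k _ => t * v k, fun _ _ => rfl⟩
  have hcol : ∀ B : Matrix κ κ ℝ, B.mulVec v = c • v →
      B * X = X * Matrix.diagonal (fun _ : Fin 1 => c) := by
    intro B hB
    ext k i
    have := congrFun hB k
    simp only [Matrix.mulVec, dotProduct, Pi.smul_apply, smul_eq_mul] at this
    rw [Matrix.mul_diagonal, Matrix.mul_apply]
    simp only [hX]
    rw [show t * v k * c = t * (c * v k) by ring, ← this, Finset.mul_sum]
    exact Finset.sum_congr rfl fun _ _ => by ring
  refine ⟨X, ?_, hcol A h1, hcol _ h2⟩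
  ext i j
  rw [Subsingleton.elim i j, Matrix.one_apply_eq, ← ht]
  simp only [Matrix.mul_apply, Matrix.transpose_apply, hX, dotProduct]
  rw [Finset.mul_sum]
  exact Finset.sum_congr rfl fun _ _ => by ring

/-- A two-dimensional invariant subspace of a normal matrix on which it acts as a scaled rotation. -/
theorem exists_orthonormal_pair {κ : Type*} [Fintype κ] [DecidableEq κ] (A : Matrix κ κ ℝ)
    (hA : A * A.transpose = A.transpose * A) (c d : ℝ) (hd : d ≠ 0) (x y : κ → ℝ)
    (hxy : x ≠ 0 ∨ y ≠ 0) (hx : A.mulVec x = c • x + d • y) (hy : A.mulVec y = c • y - d • x) :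
    ∃ X : Matrix κ (Fin 1 ⊕ Fin 1) ℝ, X.transpose * X = 1 ∧
      A * X = X * pairBlock (fun _ : Fin 1 => c) (fun _ => d) ∧
      A.transpose * X = X * (pairBlock (fun _ : Fin 1 => c) (fun _ => d)).transpose := by
  have hAA : ∀ u v : κ → ℝ, A.transpose.mulVec u ⬝ᵥ A.transpose.mulVec v =
      A.mulVec u ⬝ᵥ A.mulVec v := by
    intro u v
    rw [Matrix.dotProduct_mulVec, Matrix.vecMul_transpose, Matrix.mulVec_mulVec, hA,
      Matrix.dotProduct_mulVec _ A, ← Matrix.mulVec_transpose, Matrix.mulVec_mulVec]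
  have hadj : ∀ u v : κ → ℝ, A.transpose.mulVec u ⬝ᵥ v = u ⬝ᵥ A.mulVec v := by
    intro u v
    rw [Matrix.mulVec_transpose, Matrix.dotProduct_mulVec]
  -- With `z = x + i y` the hypotheses read `A z = λ z` for `λ = c - i d`. The sum is `‖Aᵀ z - λ̄
  -- z‖²`, which for normal `A` equals `‖A z - λ z‖² = 0`.
  have hsum : (A.transpose.mulVec x - (c • x - d • y)) ⬝ᵥ (A.transpose.mulVec x - (c • x - d • y)) +
      (A.transpose.mulVec y - (c • y + d • x)) ⬝ᵥ (A.transpose.mulVec y - (c • y + d • x)) = 0 := by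
    have e1 := hadj x x
    have e2 := hadj x y
    have e3 := hadj y x
    have e4 := hadj y y
    have e5 := hAA x x
    have e6 := hAA y y
    simp only [hx, hy, dotProduct_add, dotProduct_sub, add_dotProduct, sub_dotProduct,
      dotProduct_smul, smul_dotProduct, smul_eq_mul] at e1 e2 e3 e4 e5 e6 ⊢
    rw [dotProduct_comm x (A.transpose.mulVec x), dotProduct_comm y (A.transpose.mulVec x),
      dotProduct_comm x (A.transpose.mulVec y), dotProduct_comm y (A.transpose.mulVec y),
      e1, e2, e3, e4, e5, e6]
    ring
  have hnn : ∀ u : κ → ℝ, 0 ≤ u ⬝ᵥ u := fun u => Finset.sum_nonneg fun i _ => mul_self_nonneg _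
  have hx' : A.transpose.mulVec x = c • x - d • y := by
    rw [← sub_eq_zero, ← dotProduct_self_eq_zero]
    exact ((add_eq_zero_iff_of_nonneg (hnn _) (hnn _)).1 hsum).1
  have hy' : A.transpose.mulVec y = c • y + d • x := by
    rw [← sub_eq_zero, ← dotProduct_self_eq_zero]
    exact ((add_eq_zero_iff_of_nonneg (hnn _) (hnn _)).1 hsum).2
  -- Equality of norms and orthogonality follow from comparing `⟨Aᵀ y, x⟩ = ⟨y, A x⟩` and `⟨Aᵀ x, x⟩
  -- = ⟨x, A x⟩`; both use `d ≠ 0`.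
  have hnorm : y ⬝ᵥ y = x ⬝ᵥ x := by
    have h := hadj y x
    simp only [hx, hy', dotProduct_add, add_dotProduct, dotProduct_smul, smul_dotProduct,
      smul_eq_mul] at h
    exact mul_left_cancel₀ hd (by linarith)
  have horth : x ⬝ᵥ y = 0 := by
    have h := hadj x x
    simp only [hx, hx', dotProduct_add, sub_dotProduct, dotProduct_smul, smul_dotProduct,
      smul_eq_mul, dotProduct_comm y x] at h
    have : d * (x ⬝ᵥ y) = 0 := by linarith
    exact (mul_eq_zero.1 this).resolve_left hd
  have hpos : 0 < x ⬝ᵥ x := by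
    refine lt_of_le_of_ne (hnn _) fun h => ?_
    rcases hxy with h' | h'
    · exact h' (dotProduct_self_eq_zero.1 h.symm)
    · exact h' (dotProduct_self_eq_zero.1 (hnorm.trans h.symm))
  obtain ⟨t, ht⟩ : ∃ t : ℝ, t * t * (x ⬝ᵥ x) = 1 := ⟨(√(x ⬝ᵥ x))⁻¹, by
    rw [← mul_inv, Real.mul_self_sqrt hpos.le, inv_mul_cancel₀ hpos.ne']⟩
  obtain ⟨X, hX⟩ : ∃ X : Matrix κ (Fin 1 ⊕ Fin 1) ℝ,
      ∀ k, (∀ i, X k (Sum.inl i) = t * x k) ∧ ∀ i, X k (Sum.inr i) = t * y k :=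
    ⟨Matrix.of fun k => Sum.elim (fun _ => t * x k) (fun _ => t * y k),
      fun _ => ⟨fun _ => rfl, fun _ => rfl⟩⟩
  have hval : ∀ (B : Matrix κ κ ℝ) (e : ℝ), B.mulVec x = c • x + e • y →
      B.mulVec y = c • y - e • x →
      B * X = X * pairBlock (fun _ : Fin 1 => c) (fun _ => e) := by
    intro B e h1 h2
    ext k i
    have h1 := congrFun h1 k
    have h2 := congrFun h2 k
    simp only [Matrix.mulVec, dotProduct, Pi.smul_apply, Pi.add_apply, Pi.sub_apply,
      smul_eq_mul] at h1 h2
    rw [Matrix.mul_apply]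
    rcases i with i | i
    · have : ∑ j, B k j * (t * x j) = t * ∑ j, B k j * x j := by
        rw [Finset.mul_sum]; exact Finset.sum_congr rfl fun _ _ => by ring
      simp [this, h1, hX, Matrix.mul_apply, pairBlock, Subsingleton.elim i 0]
      ring
    · have : ∑ j, B k j * (t * y j) = t * ∑ j, B k j * y j := by
        rw [Finset.mul_sum]; exact Finset.sum_congr rfl fun _ _ => by ring
      simp [this, h2, hX, Matrix.mul_apply, pairBlock, Subsingleton.elim i 0]
      ring
  refine ⟨X, ?_, hval A d hx hy, ?_⟩
  · have hm : ∀ u v : κ → ℝ, ∑ k, t * u k * (t * v k) = t * t * (u ⬝ᵥ v) := by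
      intro u v
      rw [dotProduct, Finset.mul_sum]; exact Finset.sum_congr rfl fun _ _ => by ring
    ext (i | i) (j | j) <;>
      simp [Matrix.mul_apply, Matrix.one_apply, hX, hm, ht, hnorm, horth, dotProduct_comm y x, Subsingleton.elim i j]
  · have : (pairBlock (fun _ : Fin 1 => c) (fun _ => d)).transpose =
        pairBlock (fun _ : Fin 1 => c) (fun _ => -d) := by
      simp [pairBlock, Matrix.fromBlocks_transpose]
    rw [this]
    exact hval _ (-d) (by rw [hx']; module) (by rw [hy']; module)

/-- `x` and `y` are the real and imaginary parts of a complex eigenvector for the root `c - i d` of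
the quadratic factor. -/
theorem exists_complex_pair {κ : Type*} [Fintype κ] [DecidableEq κ] (A : Matrix κ κ ℝ) (c d : ℝ)
    (h : ((Polynomial.X - Polynomial.C c) ^ 2 + Polynomial.C d ^ 2) ∣ A.charpoly) :
    ∃ x y : κ → ℝ, (x ≠ 0 ∨ y ≠ 0) ∧ A.mulVec x = c • x + d • y ∧ A.mulVec y = c • y - d • x := by
  have hdet : (Matrix.scalar κ (c - d * Complex.I) - A.map Complex.ofRealHom).det = 0 := by
    rw [← Matrix.eval_charpoly, Matrix.charpoly_map]
    obtain ⟨q, hq⟩ := h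
    rw [hq]
    simp only [Polynomial.map_mul, Polynomial.eval_mul]
    refine mul_eq_zero_of_left ?_ _
    simp [mul_pow]
  obtain ⟨z, hz, hAz⟩ := Matrix.exists_mulVec_eq_zero_iff.2 hdet
  refine ⟨fun k => (z k).re, fun k => (z k).im, ?_, ?_, ?_⟩
  · by_contra! h
    exact hz (funext fun k => Complex.ext (congrFun h.1 k) (congrFun h.2 k))
  all_goals
    ext k
    have hk := congrFun hAz k
    rw [Matrix.sub_mulVec, Pi.sub_apply, Pi.zero_apply, sub_eq_zero, Matrix.scalar_apply,
      Matrix.mulVec_diagonal] at hk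
    simp only [Matrix.mulVec, dotProduct, Matrix.map_apply] at hk
  · have := congrArg Complex.re hk
    simp [Matrix.mulVec, dotProduct] at this ⊢
    linarith
  · have := congrArg Complex.im hk
    simp [Matrix.mulVec, dotProduct] at this ⊢
    linarith

theorem charpoly_pairBlock_one (c d : ℝ) :
    (pairBlock (fun _ : Fin 1 => c) (fun _ => d)).charpoly =
      (Polynomial.X - Polynomial.C c) ^ 2 + Polynomial.C d ^ 2 := by
  rw [← Matrix.charpoly_reindex (finSumFinEquiv (m := 1) (n := 1))]
  have : (Matrix.reindex (finSumFinEquiv (m := 1) (n := 1)) (finSumFinEquiv (m := 1) (n := 1)))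
      (pairBlock (fun _ : Fin 1 => c) (fun _ => d)) = !![c, -d; d, c] := by
    ext i j
    fin_cases i <;> fin_cases j <;> rfl
  rw [this, Matrix.charpoly_fin_two]
  simp [Matrix.trace_fin_two, Matrix.det_fin_two]
  ring

theorem exists_invariant_pair {κ : Type*} [Fintype κ] [DecidableEq κ] (A : Matrix κ κ ℝ)
    (hA : A * A.transpose = A.transpose * A) (c d : ℝ)
    (h : ((Polynomial.X - Polynomial.C c) ^ 2 + Polynomial.C d ^ 2) ∣ A.charpoly) :
    ∃ X : Matrix κ (Fin 1 ⊕ Fin 1) ℝ, X.transpose * X = 1 ∧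
      A * X = X * pairBlock (fun _ : Fin 1 => c) (fun _ => d) ∧
      A.transpose * X = X * (pairBlock (fun _ : Fin 1 => c) (fun _ => d)).transpose := by
  -- For `d = 0` the real and imaginary parts of an eigenvector may be dependent. The double root
  -- `c` is then split off in two steps, with an eigenvector of the deflated matrix `D` as the
  -- second vector.
  by_cases hd : d = 0
  swap
  · obtain ⟨x, y, hxy, hx, hy⟩ := exists_complex_pair A c d h
    exact exists_orthonormal_pair A hA c d hd x y hxy hx hy
  subst hd
  simp only [map_zero, ne_eq, OfNat.ofNat_ne_zero, not_false_eq_true, zero_pow, add_zero] at h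
  obtain ⟨X₁, hX₁, hA₁, hA₁'⟩ := exists_real_eigenvector A hA c
    ((dvd_pow_self _ two_ne_zero).trans h)
  have hcard : 1 ≤ Fintype.card κ := by
    rw [← Matrix.charpoly_natDegree_eq_dim A]
    have := Polynomial.natDegree_le_of_dvd h (Matrix.charpoly_monic A).ne_zero
    rw [Polynomial.natDegree_pow, Polynomial.natDegree_X_sub_C] at this
    omega
  have hc : Fintype.card κ = Fintype.card (Fin 1 ⊕ Fin (Fintype.card κ - 1)) := by
    rw [Fintype.card_sum, Fintype.card_fin, Fintype.card_fin]; omega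
  obtain ⟨Q, D, hQ, hQ', hD⟩ := exists_blockDiagonal (τ := Fin (Fintype.card κ - 1)) hc A X₁
    (Matrix.diagonal fun _ => c) hX₁ hA₁ (by simpa using hA₁')
  have hchar : A.charpoly = (Polynomial.X - Polynomial.C c) * D.charpoly := by
    rw [← charpoly_conj A Q hc hQ', hD, Matrix.charpoly_fromBlocks_zero₁₂,
      Matrix.charpoly_diagonal]
    simp
  have hDN := normal_of_conj_fromBlocks hQ' hA hD
  obtain ⟨Y, hY, hDY, hDY'⟩ := exists_real_eigenvector D hDN c (by
    rw [hchar, sq] at h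
    exact (mul_dvd_mul_iff_left (Polynomial.X_sub_C_ne_zero c)).1 h)
  have hAQ : A * Q = Q * Matrix.fromBlocks (Matrix.diagonal fun _ : Fin 1 => c) 0 0 D := by
    rw [← hD, ← Matrix.mul_assoc, ← Matrix.mul_assoc, hQ', Matrix.one_mul]
  have hAQ' : A.transpose * Q =
      Q * Matrix.fromBlocks (Matrix.diagonal fun _ : Fin 1 => c) 0 0 D.transpose := by
    have := transpose_conj A Q
    rw [hD, Matrix.fromBlocks_transpose, Matrix.diagonal_transpose, Matrix.transpose_zero,
      Matrix.transpose_zero] at this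
    rw [this, ← Matrix.mul_assoc, ← Matrix.mul_assoc, hQ', Matrix.one_mul]
  have hP : pairBlock (fun _ : Fin 1 => c) (fun _ => 0) =
      Matrix.fromBlocks (Matrix.diagonal fun _ : Fin 1 => c) 0 0
        (Matrix.diagonal fun _ : Fin 1 => c) := by
    simp [pairBlock]
  refine ⟨Q * Matrix.fromBlocks (1 : Matrix (Fin 1) (Fin 1) ℝ) 0 0 Y, ?_, ?_, ?_⟩
  · rw [Matrix.transpose_mul, Matrix.mul_assoc, ← Matrix.mul_assoc _ Q, hQ, Matrix.one_mul]
    simp [Matrix.fromBlocks_transpose, Matrix.fromBlocks_multiply, hY]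
  · rw [← Matrix.mul_assoc, hAQ, Matrix.mul_assoc, Matrix.mul_assoc, hP]
    simp [Matrix.fromBlocks_multiply, hDY, -Matrix.fromBlocks_diagonal]
  · rw [← Matrix.mul_assoc, hAQ', Matrix.mul_assoc, Matrix.mul_assoc, hP]
    simp [Matrix.fromBlocks_transpose, Matrix.fromBlocks_multiply, hDY', -Matrix.fromBlocks_diagonal]

/-- The index splitting that separates the first pair from the others. -/
def splitFirstPair {n : ℕ} : Fin (n + 1) ⊕ Fin (n + 1) → (Fin 1 ⊕ Fin 1) ⊕ (Fin n ⊕ Fin n) :=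
  Sum.elim (Fin.cons (Sum.inl (Sum.inl 0)) fun i => Sum.inr (Sum.inl i))
    (Fin.cons (Sum.inl (Sum.inr 0)) fun i => Sum.inr (Sum.inr i))

theorem splitFirstPair_injective {n : ℕ} : Function.Injective (splitFirstPair (n := n)) := by
  rintro (i | i) (j | j) <;> cases i using Fin.cases <;> cases j using Fin.cases <;>
    simp [splitFirstPair]

theorem fromBlocks_pairBlock_submatrix {n : ℕ} (c d : ℝ) (γ δ : Fin n → ℝ) :
    (Matrix.fromBlocks (pairBlock (fun _ : Fin 1 => c) (fun _ => d)) 0 0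
      (pairBlock γ δ)).submatrix splitFirstPair splitFirstPair =
      pairBlock (Fin.cons c γ : Fin (n + 1) → ℝ) (Fin.cons d δ) := by
  ext (i | i) (j | j) <;> cases i using Fin.cases <;> cases j using Fin.cases <;>
    simp [splitFirstPair, pairBlock, Matrix.diagonal_apply, Fin.succ_ne_zero,
      (Fin.succ_ne_zero _).symm]

/-- Inductive step shared by the normal and the skew case: the normal form of the deflated block is
carried back through `Q`, and the indices are relabelled so that the split-off pair comes first. -/
theorem exists_pairBlock_cons {n : ℕ} {κ : Type*} [Fintype κ] {A : Matrix κ κ ℝ}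
    {Q : Matrix κ ((Fin 1 ⊕ Fin 1) ⊕ (Fin n ⊕ Fin n)) ℝ} {c d : ℝ}
    {D U : Matrix (Fin n ⊕ Fin n) (Fin n ⊕ Fin n) ℝ} {γ δ : Fin n → ℝ}
    (hQ : Q.transpose * Q = 1)
    (hD : Q.transpose * A * Q =
      Matrix.fromBlocks (pairBlock (fun _ : Fin 1 => c) (fun _ => d)) 0 0 D)
    (hU : U.transpose * U = 1) (hDU : U.transpose * D * U = pairBlock γ δ) :
    ∃ R : Matrix κ (Fin (n + 1) ⊕ Fin (n + 1)) ℝ, R.transpose * R = 1 ∧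
      R.transpose * A * R = pairBlock (Fin.cons c γ : Fin (n + 1) → ℝ) (Fin.cons d δ) := by
  let E : Matrix ((Fin 1 ⊕ Fin 1) ⊕ (Fin n ⊕ Fin n)) ((Fin 1 ⊕ Fin 1) ⊕ (Fin n ⊕ Fin n)) ℝ :=
    Matrix.fromBlocks 1 0 0 U
  let R₀ : Matrix κ ((Fin 1 ⊕ Fin 1) ⊕ (Fin n ⊕ Fin n)) ℝ := Q * E
  have h1 : R₀.transpose * R₀ = 1 := by
    simp only [R₀]
    rw [Matrix.transpose_mul, Matrix.mul_assoc, ← Matrix.mul_assoc _ Q, hQ, Matrix.one_mul]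
    simp [E, Matrix.fromBlocks_transpose, Matrix.fromBlocks_multiply, hU]
  have h2 : R₀.transpose * A * R₀ =
      Matrix.fromBlocks (pairBlock (fun _ : Fin 1 => c) (fun _ => d)) 0 0 (pairBlock γ δ) := by
    have : R₀.transpose * A * R₀ = E.transpose * (Q.transpose * A * Q) * E := by
      simp only [R₀, Matrix.transpose_mul, Matrix.mul_assoc]
    rw [this, hD]
    simp [E, Matrix.fromBlocks_transpose, Matrix.fromBlocks_multiply, hDU]
  refine ⟨R₀.submatrix id splitFirstPair, ?_, ?_⟩
  · rw [← Matrix.submatrix_one _ splitFirstPair_injective, ← h1]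
    rfl
  · rw [← fromBlocks_pairBlock_submatrix, ← h2]
    rfl

/-- Real normal form of a normal matrix, in a prescribed order of the eigenvalue pairs. -/
theorem exists_pairBlock_of_normal (n : ℕ) (A : Matrix (Fin n ⊕ Fin n) (Fin n ⊕ Fin n) ℝ)
    (γ δ : Fin n → ℝ) (hA : A * A.transpose = A.transpose * A)
    (h : A.charpoly = ∏ l : Fin n,
      ((Polynomial.X - Polynomial.C (γ l)) ^ 2 + Polynomial.C (δ l) ^ 2)) :
    ∃ U : Matrix (Fin n ⊕ Fin n) (Fin n ⊕ Fin n) ℝ,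
      U.transpose * U = 1 ∧ U.transpose * A * U = pairBlock γ δ := by
  induction n with
  | zero => exact ⟨1, by simp, Subsingleton.elim _ _⟩
  | succ n ih =>
    rw [Fin.prod_univ_succ] at h
    obtain ⟨X, hX, hAX, hAX'⟩ := exists_invariant_pair A hA (γ 0) (δ 0) ⟨_, h⟩
    have hc : Fintype.card (Fin (n + 1) ⊕ Fin (n + 1)) =
        Fintype.card ((Fin 1 ⊕ Fin 1) ⊕ (Fin n ⊕ Fin n)) := by
      simp only [Fintype.card_sum, Fintype.card_fin]; omega
    obtain ⟨Q, D, hQ, hQ', hD⟩ := exists_blockDiagonal (τ := Fin n ⊕ Fin n) hc A X _ hX hAX hAX'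
    have hDN := normal_of_conj_fromBlocks hQ' hA hD
    rw [← charpoly_conj A Q hc hQ', hD, Matrix.charpoly_fromBlocks_zero₁₂,
      charpoly_pairBlock_one] at h
    have hne : (Polynomial.X - Polynomial.C (γ 0)) ^ 2 + Polynomial.C (δ 0) ^ 2 ≠ 0 := by
      rw [← charpoly_pairBlock_one]; exact (Matrix.charpoly_monic _).ne_zero
    -- Cancelling the first quadratic factor leaves the characteristic polynomial of the deflated
    -- block, so the prescribed order of the pairs is kept.
    obtain ⟨U, hU, hDU⟩ := ih D (fun l => γ l.succ) (fun l => δ l.succ) hDN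
      (mul_left_cancel₀ hne h)
    obtain ⟨R, hR, hAR⟩ := exists_pairBlock_cons hQ hD hU hDU
    refine ⟨R, hR, hAR.trans ?_⟩
    congr 1 <;> exact Fin.cons_self_tail _

/-! ### Normal form and rank of skew-symmetric matrices -/

/-- No factorization of the characteristic polynomial is needed. For an eigenvector `v` of `Aᵀ A =
-A²` with eigenvalue `t > 0`, the matrix `A` acts on the span of `v` and `A v / √t` as a quarter
turn scaled by `√t`. -/
theorem exists_pairBlock_of_skew (n : ℕ) (A : Matrix (Fin n ⊕ Fin n) (Fin n ⊕ Fin n) ℝ)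
    (hA : A.transpose = -A) :
    ∃ (U : Matrix (Fin n ⊕ Fin n) (Fin n ⊕ Fin n) ℝ) (δ : Fin n → ℝ), (∀ l, 0 ≤ δ l) ∧
      U.transpose * U = 1 ∧ U.transpose * A * U = pairBlock 0 δ := by
  induction n with
  | zero => exact ⟨1, 0, by simp, by simp, Subsingleton.elim _ _⟩
  | succ n ih =>
    by_cases h0 : A = 0
    · exact ⟨1, 0, by simp, by simp, by simp [h0, pairBlock]⟩
    have hN : A * A.transpose = A.transpose * A := by rw [hA]; simp
    have hne : A.transpose * A ≠ 0 := by
      intro h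
      exact h0 (Matrix.conjTranspose_mul_self_eq_zero.1
        (by rwa [Matrix.conjTranspose_eq_transpose_of_trivial]))
    obtain ⟨v, t, ht, hv, hAv⟩ := Matrix.IsHermitian.exists_eigenvector_of_ne_zero
      (A := A.transpose * A) (by
        rw [← Matrix.conjTranspose_eq_transpose_of_trivial]
        exact Matrix.isHermitian_conjTranspose_mul_self A) hne
    have hnn : ∀ u : Fin (n + 1) ⊕ Fin (n + 1) → ℝ, 0 ≤ u ⬝ᵥ u :=
      fun u => Finset.sum_nonneg fun i _ => mul_self_nonneg _
    have hvv : 0 < v ⬝ᵥ v :=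
      lt_of_le_of_ne (hnn v) fun h => hv (dotProduct_self_eq_zero.1 h.symm)
    have htpos : 0 < t := by
      have h1 : A.mulVec v ⬝ᵥ A.mulVec v = t * (v ⬝ᵥ v) := by
        rw [Matrix.dotProduct_mulVec, ← Matrix.mulVec_transpose, Matrix.mulVec_mulVec, hAv,
          smul_dotProduct, smul_eq_mul]
      have h2 := hnn (A.mulVec v)
      rw [h1] at h2
      exact lt_of_le_of_ne (nonneg_of_mul_nonneg_left h2 hvv) ht.symm
    have hs : 0 < √t := Real.sqrt_pos.2 htpos
    obtain ⟨X, hX, hAX, hAX'⟩ := exists_orthonormal_pair A hN 0 (√t) hs.ne' v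
      ((√t)⁻¹ • A.mulVec v) (Or.inl hv) (by rw [zero_smul, zero_add, smul_inv_smul₀ hs.ne'])
      (by
        have h1 : A.mulVec (A.mulVec v) = -(t • v) := by
          rw [← hAv, hA, Matrix.neg_mul, Matrix.neg_mulVec, neg_neg, Matrix.mulVec_mulVec]
        rw [Matrix.mulVec_smul, h1, zero_smul, zero_sub, smul_neg, smul_smul]
        congr 2
        rw [inv_mul_eq_div, Real.div_sqrt])
    have hc : Fintype.card (Fin (n + 1) ⊕ Fin (n + 1)) =
        Fintype.card ((Fin 1 ⊕ Fin 1) ⊕ (Fin n ⊕ Fin n)) := by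
      simp only [Fintype.card_sum, Fintype.card_fin]; omega
    obtain ⟨Q, D, hQ, hQ', hD⟩ := exists_blockDiagonal (τ := Fin n ⊕ Fin n) hc A X _ hX hAX hAX'
    have hDs : D.transpose = -D := by
      have := transpose_conj A Q
      rw [hA, Matrix.mul_neg, Matrix.neg_mul, hD, Matrix.fromBlocks_transpose,
        Matrix.fromBlocks_neg, Matrix.fromBlocks_inj] at this
      exact this.2.2.2
    obtain ⟨U, δ, hδ, hU, hDU⟩ := ih D hDs
    obtain ⟨R, hR, hAR⟩ := exists_pairBlock_cons hQ hD hU hDU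
    refine ⟨R, Fin.cons (√t) δ, Fin.cases hs.le hδ, hR, hAR.trans ?_⟩
    congr 1
    ext l
    cases l using Fin.cases <;> simp

theorem exists_antitone_pairBlock_of_skew (n : ℕ)
    (A : Matrix (Fin n ⊕ Fin n) (Fin n ⊕ Fin n) ℝ) (hA : A.transpose = -A) :
    ∃ (U : Matrix (Fin n ⊕ Fin n) (Fin n ⊕ Fin n) ℝ) (δ : Fin n → ℝ), Antitone δ ∧
      (∀ l, 0 ≤ δ l) ∧ U.transpose * U = 1 ∧ U.transpose * A * U = pairBlock 0 δ := by
  obtain ⟨U, δ, hδ, hU, hAU⟩ := exists_pairBlock_of_skew n A hA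
  let p := Tuple.sort fun l => -δ l
  have hp : Antitone (δ ∘ p) := fun i j hij => by
    have := Tuple.monotone_sort (fun l => -δ l) hij
    simpa [p] using this
  have hinj : Function.Injective (Sum.map p p) := p.injective.sumMap p.injective
  refine ⟨U.submatrix id (Sum.map p p), δ ∘ p, hp, fun l => hδ _, ?_, ?_⟩
  · rw [← Matrix.submatrix_one _ hinj, ← hU]
    rfl
  · have : pairBlock 0 (δ ∘ p) = (pairBlock 0 δ).submatrix (Sum.map p p) (Sum.map p p) := by
      ext (i | i) (j | j) <;> simp [pairBlock, Matrix.diagonal_apply]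
    rw [this, ← hAU]
    rfl

/-- Up to an invertible factor the matrix is `diag(δ, δ)`. The count links the rank of the target to
the positions of its nonzero blocks. -/
theorem rank_pairBlock_zero {n : ℕ} (δ : Fin n → ℝ) :
    (pairBlock 0 δ).rank = 2 * (Finset.univ.filter fun l => δ l ≠ 0).card := by
  let J : Matrix (Fin n ⊕ Fin n) (Fin n ⊕ Fin n) ℝ := Matrix.fromBlocks 0 (-1) 1 0
  have hJ : IsUnit J.det := by
    rw [← Matrix.isUnit_iff_isUnit_det]
    refine IsUnit.of_mul_eq_one (Matrix.fromBlocks 0 1 (-1) 0) ?_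
    simp [J, Matrix.fromBlocks_multiply]
  have h : pairBlock 0 δ = J * Matrix.diagonal (Sum.elim δ δ) := by
    rw [← Matrix.fromBlocks_diagonal]
    simp [J, pairBlock, Matrix.fromBlocks_multiply, -Matrix.fromBlocks_diagonal]
  rw [h, Matrix.rank_mul_eq_right_of_isUnit_det _ _ hJ, Matrix.rank_diagonal,
    Fintype.card_congr (Equiv.subtypeSum (p := fun i => Sum.elim δ δ i ≠ 0)), Fintype.card_sum,
    Fintype.card_subtype, Fintype.card_subtype, two_mul]
  rfl

theorem rank_conj {κ : Type*} [Fintype κ] [DecidableEq κ] (A U : Matrix κ κ ℝ)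
    (hU : U.transpose * U = 1) : (U.transpose * A * U).rank = A.rank := by
  have h1 : IsUnit U := IsUnit.of_mul_eq_one_right _ hU
  have h2 : IsUnit U.transpose := IsUnit.of_mul_eq_one _ hU
  rw [Matrix.rank_mul_eq_left_of_isUnit_det _ _ ((Matrix.isUnit_iff_isUnit_det _).1 h1),
    Matrix.rank_mul_eq_right_of_isUnit_det _ _ ((Matrix.isUnit_iff_isUnit_det _).1 h2)]

/-! ### Singular values forced by the target -/

theorem IsExploration.add_transpose {n m : ℕ} {α₁ α₂ : ℝ}
    {Td : Matrix (Fin n ⊕ Fin n) (Fin n ⊕ Fin n) ℝ} {W : Matrix (Fin n ⊕ Fin n) (Fin m) ℝ}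
    (h : IsExploration α₁ α₂ Td W) :
    Td + Td.transpose = (2 * α₂ - (α₁ + α₂) ^ 2) • (W * W.transpose) := by
  obtain ⟨hW, rfl⟩ := h
  have hL := strictLower_add_transpose W hW
  have hG : (W * W.transpose).transpose = W * W.transpose := by simp
  rw [explorationT_eq, Matrix.transpose_add, Matrix.transpose_smul, Matrix.transpose_smul, hG]
  generalize W * strictLowerOnes m * W.transpose = L at hL ⊢
  rw [← eq_sub_iff_add_eq'] at hL
  rw [hL]
  module

/-- A Gram matrix of full rank forces at least `2n` columns, so every prescribed singular value has
a place on the diagonal. -/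
theorem two_mul_le_of_gram {n m : ℕ} (W : Matrix (Fin n ⊕ Fin n) (Fin m) ℝ)
    (U : Matrix (Fin n ⊕ Fin n) (Fin n ⊕ Fin n) ℝ) (d : Fin n ⊕ Fin n → ℝ)
    (hG : U.transpose * (W * W.transpose) * U = Matrix.diagonal d) (hd : ∀ k, d k ≠ 0) :
    2 * n ≤ m := by
  have h1 : (Matrix.diagonal d).rank = 2 * n := by
    rw [Matrix.rank_of_det_ne_zero]
    · simp [two_mul]
    · rw [Matrix.det_diagonal]
      exact Finset.prod_ne_zero_iff.2 fun k _ => hd k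
  rw [← h1, ← hG]
  calc _ ≤ (U.transpose * (W * W.transpose)).rank := Matrix.rank_mul_le_left _ _
    _ ≤ (W * W.transpose).rank := Matrix.rank_mul_le_right _ _
    _ ≤ W.rank := Matrix.rank_mul_le_left _ _
    _ ≤ m := by simpa using Matrix.rank_le_card_width W

/-- Common core of the two rigidity statements: `Td + Tdᵀ` is a nonzero multiple of the Gram matrix,
so `Uᵀ W Wᵀ U` has the entry `2γ_l / c` at both members of the `l`-th pair. An SVD with left factor
`U` has the squared singular values there. -/
theorem IsExploration.isSVD_of_diagonal {n m : ℕ} {α₁ α₂ : ℝ}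
    {Td : Matrix (Fin n ⊕ Fin n) (Fin n ⊕ Fin n) ℝ} {W : Matrix (Fin n ⊕ Fin n) (Fin m) ℝ}
    (h : IsExploration α₁ α₂ Td W) (hα : 2 * α₂ - (α₁ + α₂) ^ 2 ≠ 0)
    (U : Matrix (Fin n ⊕ Fin n) (Fin n ⊕ Fin n) ℝ) (hU : U.transpose * U = 1) (γ : Fin n → ℝ)
    (hT : U.transpose * (Td + Td.transpose) * U =
      Matrix.diagonal fun k => 2 * Sum.elim γ γ k)
    (hγ : ∀ l, 0 < (2 * α₂ - (α₁ + α₂) ^ 2) * γ l) :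
    (∃ (σ₁ σ₂ : Fin n → ℝ) (V : Matrix (Fin m) (Fin m) ℝ), IsSVD W U σ₁ σ₂ V) ∧
    (∀ (σ₁ σ₂ : Fin n → ℝ) (V : Matrix (Fin m) (Fin m) ℝ), IsSVD W U σ₁ σ₂ V →
      ∀ l, 0 < σ₁ l ∧ σ₁ l = σ₂ l ∧ γ l = (α₂ - 1 / 2 * (α₁ + α₂) ^ 2) * σ₁ l ^ 2) := by
  rw [h.add_transpose] at hT
  set c := 2 * α₂ - (α₁ + α₂) ^ 2 with hc
  have hU' := mul_eq_one_comm.1 hU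
  have hG : U.transpose * (W * W.transpose) * U =
      Matrix.diagonal fun k => 2 * Sum.elim γ γ k / c := by
    rw [Matrix.mul_smul, Matrix.smul_mul] at hT
    rw [← inv_smul_smul₀ hα (U.transpose * (W * W.transpose) * U), hT, ← Matrix.diagonal_smul]
    congr 1
    ext k
    simp [div_eq_inv_mul]
  have hpos : ∀ l, 0 < 2 * γ l / c := fun l => by
    have : 2 * γ l / c = 2 * (c * γ l) / c ^ 2 := by field_simp
    rw [this]
    exact div_pos (mul_pos two_pos (hγ l)) (sq_pos_of_ne_zero hα)
  refine ⟨?_, ?_⟩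
  · refine ⟨fun l => √(2 * γ l / c), fun l => √(2 * γ l / c), ?_⟩
    refine exists_isSVD W U _ _ hU (fun l => ⟨Real.sqrt_nonneg _, Real.sqrt_nonneg _⟩)
      (two_mul_le_of_gram W U _ hG ?_) ?_
    · rintro (l | l) <;> exact (hpos l).ne'
    · have : (Matrix.diagonal fun k => Sum.elim (fun l => √(2 * γ l / c))
          (fun l => √(2 * γ l / c)) k ^ 2) = Matrix.diagonal fun k => 2 * Sum.elim γ γ k / c := by
        congr 1
        ext (l | l) <;> exact Real.sq_sqrt (hpos l).le
      rw [this, ← hG, Matrix.mul_assoc, Matrix.mul_assoc, hU', Matrix.mul_one, ← Matrix.mul_assoc,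
        hU', Matrix.one_mul]
  · intro σ₁ σ₂ V hS l
    have hS' := hS.gram
    rw [hS', Matrix.mul_assoc, Matrix.mul_assoc, hU, Matrix.mul_one, ← Matrix.mul_assoc, hU,
      Matrix.one_mul] at hG
    have h1 : σ₁ l ^ 2 = 2 * γ l / c := congrFun (Matrix.diagonal_injective hG) (Sum.inl l)
    have h2 : σ₂ l ^ 2 = 2 * γ l / c := congrFun (Matrix.diagonal_injective hG) (Sum.inr l)
    have hnn := hS.2.2.1 l
    refine ⟨lt_of_le_of_ne hnn.1 fun h0 => ?_, (sq_eq_sq₀ hnn.1 hnn.2).1 (h1.trans h2.symm), ?_⟩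
    · rw [← h0] at h1
      have := hpos l
      simp [← h1] at this
    · rw [h1, show α₂ - 1 / 2 * (α₁ + α₂) ^ 2 = c / 2 by rw [hc]; ring]
      field_simp

/-! ### Construction of exploration sequences with a prescribed SVD -/

theorem exists_isExploration_isSVD {n : ℕ} (α₁ α₂ : ℝ) (hα : α₁ + α₂ ≠ 0) (σ₁ σ₂ δ : Fin n → ℝ)
    (hσ : ∀ l, 0 ≤ σ₁ l ∧ 0 ≤ σ₂ l) (hδ : ∀ l, 0 ≤ δ l) (h : ∀ l, σ₁ l * σ₂ l = 0 → δ l = 0)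
    (U Td : Matrix (Fin n ⊕ Fin n) (Fin n ⊕ Fin n) ℝ) (hU : U.transpose * U = 1)
    (hT : U.transpose * Td * U = (α₂ - 1 / 2 * (α₁ + α₂) ^ 2) •
      (Matrix.diagonal fun k => Sum.elim σ₁ σ₂ k ^ 2) + pairBlock 0 δ) :
    ∃ (m : ℕ) (W : Matrix (Fin n ⊕ Fin n) (Fin m) ℝ) (V : Matrix (Fin m) (Fin m) ℝ),
      2 * n + 1 ≤ m ∧ IsExploration α₁ α₂ Td W ∧ IsSVD W U σ₁ σ₂ V := by
  have hα2 : 0 < (α₁ + α₂) ^ 2 := sq_pos_of_ne_zero hα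
  have hU' := mul_eq_one_comm.1 hU
  -- `T` multiplies areas by `(α₁ + α₂)²`, so the polygon has to provide `δ l / (α₁ + α₂)²`.
  obtain ⟨m, hm, hR⟩ := exists_realizes_pairBlock σ₁ σ₂ (fun l => δ l / (α₁ + α₂) ^ 2) hσ
    (fun l => div_nonneg (hδ l) hα2.le) (fun l hl => by simp [h l hl]) (2 * n + 1)
  obtain ⟨W, hW, hG, hL⟩ := hR.map U
  rw [Matrix.mulVec_zero] at hW
  obtain ⟨V, hV⟩ := exists_isSVD W U σ₁ σ₂ hU hσ (by omega) hG
  refine ⟨m, W, V, hm, ⟨hW, ?_⟩, hV⟩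
  have hT' : Td = U * (U.transpose * Td * U) * U.transpose := by
    rw [Matrix.mul_assoc, Matrix.mul_assoc, hU', Matrix.mul_one, ← Matrix.mul_assoc, hU',
      Matrix.one_mul]
  have hp : pairBlock 0 δ = (α₁ + α₂) ^ 2 • pairBlock 0 (fun l => δ l / (α₁ + α₂) ^ 2) := by
    ext (i | i) (j | j) <;> simp [pairBlock, Matrix.diagonal_apply]
    all_goals rw [mul_div_cancel₀ _ hα2.ne']
  rw [hT', hT, hp, explorationT_eq, hG, hL]
  simp only [Matrix.mul_add, Matrix.add_mul, Matrix.mul_smul, Matrix.smul_mul]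
  module

/-- The coefficient of the Gram matrix vanishes, so the `σ` do not enter the target equation. It
only remains to check that no area is demanded in a plane where the singular values vanish, which
the decreasing order of `δ` and the rank guarantee. -/
theorem exists_isExploration_of_skew (n : ℕ) (α₁ α₂ : ℝ) (hα : α₁ + α₂ ≠ 0) (h0 : 2 * α₂ - (α₁ + α₂) ^ 2 = 0)
    (Td : Matrix (Fin n ⊕ Fin n) (Fin n ⊕ Fin n) ℝ) (hTd : Td.transpose = -Td)
    (σ₁ σ₂ : Fin n → ℝ) (hpos : ∀ l : Fin n, 2 * (l : ℕ) < Td.rank → 0 < σ₁ l ∧ 0 < σ₂ l)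
    (hzero : ∀ l : Fin n, Td.rank ≤ 2 * (l : ℕ) → σ₁ l = 0 ∧ σ₂ l = 0) :
    ∃ (m : ℕ) (W : Matrix (Fin n ⊕ Fin n) (Fin m) ℝ)
      (U : Matrix (Fin n ⊕ Fin n) (Fin n ⊕ Fin n) ℝ) (V : Matrix (Fin m) (Fin m) ℝ)
      (δ : Fin n → ℝ),
      Td.rank + 1 ≤ m ∧ IsExploration α₁ α₂ Td W ∧ IsSVD W U σ₁ σ₂ V ∧
      Antitone δ ∧ (∀ l, 0 ≤ δ l) ∧ U.transpose * Td * U = pairBlock 0 δ := by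
  obtain ⟨U, δ, hanti, hδ, hU, hT⟩ := exists_antitone_pairBlock_of_skew n Td hTd
  have hrank : Td.rank = 2 * (Finset.univ.filter fun l => δ l ≠ 0).card := by
    rw [← rank_conj Td U hU, hT, rank_pairBlock_zero]
  have hδ0 : ∀ l : Fin n, Td.rank ≤ 2 * (l : ℕ) → δ l = 0 := by
    intro l hl
    by_contra hne
    -- As `δ` decreases, `δ l ≠ 0` makes `δ₀, …, δ_l` nonzero, so the rank is at least `2 (l + 1)`.
    have hsub : Finset.Iic l ⊆ Finset.univ.filter fun l => δ l ≠ 0 := by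
      intro i hi
      have h1 : 0 < δ l := lt_of_le_of_ne (hδ l) (Ne.symm hne)
      simpa using (h1.trans_le (hanti (Finset.mem_Iic.1 hi))).ne'
    have := Finset.card_le_card hsub
    rw [Fin.card_Iic] at this
    omega
  have hσ : ∀ l, 0 ≤ σ₁ l ∧ 0 ≤ σ₂ l := fun l => by
    rcases lt_or_ge (2 * (l : ℕ)) Td.rank with hl | hl
    · exact ⟨(hpos l hl).1.le, (hpos l hl).2.le⟩
    · exact ⟨(hzero l hl).1.ge, (hzero l hl).2.ge⟩
  have hc : α₂ - 1 / 2 * (α₁ + α₂) ^ 2 = 0 := by linarith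
  obtain ⟨m, W, V, hm, hW, hV⟩ := exists_isExploration_isSVD α₁ α₂ hα σ₁ σ₂ δ hσ hδ
    (fun l hl => by
      rcases lt_or_ge (2 * (l : ℕ)) Td.rank with hl' | hl'
      · exact absurd hl (mul_pos (hpos l hl').1 (hpos l hl').2).ne'
      · exact hδ0 l hl') U Td hU (by rw [hT, hc, zero_smul, zero_add])
  refine ⟨m, W, U, V, δ, ?_, hW, hV, hanti, hδ, hT⟩
  have : Td.rank ≤ 2 * n := by
    simpa [two_mul] using Matrix.rank_le_card_width Td
  omega

/-! ### Normal targets -/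

theorem pairBlock_add_transpose {n : ℕ} (γ δ : Fin n → ℝ) :
    pairBlock γ δ + (pairBlock γ δ).transpose = Matrix.diagonal fun k => 2 * Sum.elim γ γ k := by
  ext (i | i) (j | j) <;>
    simp only [pairBlock, Matrix.add_apply, Matrix.transpose_apply, Matrix.fromBlocks_apply₁₁,
      Matrix.fromBlocks_apply₁₂, Matrix.fromBlocks_apply₂₁, Matrix.fromBlocks_apply₂₂,
      Matrix.neg_apply, Matrix.diagonal_apply, Sum.inl.injEq, Sum.inr.injEq, reduceCtorEq,
      if_false, Sum.elim_inl, Sum.elim_inr] <;>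
    by_cases hij : i = j <;> simp [hij, Ne.symm, two_mul]

theorem IsExploration.isSVD_of_normal (n : ℕ) (α₁ α₂ : ℝ) (hα : 2 * α₂ - (α₁ + α₂) ^ 2 ≠ 0)
    (Td : Matrix (Fin n ⊕ Fin n) (Fin n ⊕ Fin n) ℝ) (hN : Td * Td.transpose = Td.transpose * Td)
    (hP : ((2 * α₂ - (α₁ + α₂) ^ 2) • (Td + Td.transpose)).PosDef) (γ δ : Fin n → ℝ)
    (hchar : Td.charpoly = ∏ l : Fin n,
      ((Polynomial.X - Polynomial.C (γ l)) ^ 2 + Polynomial.C (δ l) ^ 2))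
    (m : ℕ) (W : Matrix (Fin n ⊕ Fin n) (Fin m) ℝ) (hW : IsExploration α₁ α₂ Td W) :
    (∃ (U : Matrix (Fin n ⊕ Fin n) (Fin n ⊕ Fin n) ℝ) (σ₁ σ₂ : Fin n → ℝ)
      (V : Matrix (Fin m) (Fin m) ℝ),
      IsSVD W U σ₁ σ₂ V ∧ U.transpose * Td * U = pairBlock γ δ) ∧
    (∀ (U : Matrix (Fin n ⊕ Fin n) (Fin n ⊕ Fin n) ℝ) (σ₁ σ₂ : Fin n → ℝ)
      (V : Matrix (Fin m) (Fin m) ℝ),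
      IsSVD W U σ₁ σ₂ V → U.transpose * Td * U = pairBlock γ δ →
      ∀ l, 0 < σ₁ l ∧ σ₁ l = σ₂ l ∧ γ l = (α₂ - 1 / 2 * (α₁ + α₂) ^ 2) * σ₁ l ^ 2) := by
  have key : ∀ U : Matrix (Fin n ⊕ Fin n) (Fin n ⊕ Fin n) ℝ, U.transpose * U = 1 →
      U.transpose * Td * U = pairBlock γ δ →
      U.transpose * (Td + Td.transpose) * U = (Matrix.diagonal fun k => 2 * Sum.elim γ γ k) ∧
      ∀ l, 0 < (2 * α₂ - (α₁ + α₂) ^ 2) * γ l := by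
    intro U hU hT
    have h1 : U.transpose * (Td + Td.transpose) * U =
        Matrix.diagonal fun k => 2 * Sum.elim γ γ k := by
      rw [Matrix.mul_add, Matrix.add_mul, ← transpose_conj, hT, pairBlock_add_transpose]
    refine ⟨h1, fun l => ?_⟩
    -- Congruence by the invertible `U` preserves positive definiteness, and the diagonal entries of
    -- the result are `2 c γ_l`.
    have h2 := hP.conjTranspose_mul_mul_same (B := U)
      (Matrix.mulVec_injective_of_isUnit (IsUnit.of_mul_eq_one_right _ hU))
    rw [Matrix.conjTranspose_eq_transpose_of_trivial, Matrix.mul_smul, Matrix.smul_mul, h1] at h2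
    have h3 := h2.diag_pos (i := Sum.inl l)
    simp only [Matrix.smul_apply, Matrix.diagonal_apply_eq, Sum.elim_inl, smul_eq_mul] at h3
    linarith
  refine ⟨?_, fun U σ₁ σ₂ V hS hT => ?_⟩
  · obtain ⟨U, hU, hT⟩ := exists_pairBlock_of_normal n Td γ δ hN hchar
    obtain ⟨h1, h2⟩ := key U hU hT
    obtain ⟨σ₁, σ₂, V, hS⟩ := (hW.isSVD_of_diagonal hα U hU γ h1 h2).1
    exact ⟨U, σ₁, σ₂, V, hS, hT⟩
  · obtain ⟨h1, h2⟩ := key U hS.1 hT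
    exact (hW.isSVD_of_diagonal hα U hS.1 γ h1 h2).2 σ₁ σ₂ V hS

theorem fromBlocks_one_eq_pairBlock {n : ℕ} (γ : Fin n → ℝ) :
    Matrix.fromBlocks (Matrix.diagonal γ) (-1) 1 (Matrix.diagonal γ) =
      pairBlock γ (fun _ => 1) := by
  simp [pairBlock]

theorem IsExploration.isSVD_one_of_fromBlocks (n : ℕ) (α₁ α₂ : ℝ) (hα : 2 * α₂ - (α₁ + α₂) ^ 2 ≠ 0)
    (γ γ' : Fin n → ℝ) (Td : Matrix (Fin n ⊕ Fin n) (Fin n ⊕ Fin n) ℝ)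
    (hTd : Td = Matrix.fromBlocks (Matrix.diagonal γ) (-1) 1 (Matrix.diagonal γ'))
    (hN : Td * Td.transpose = Td.transpose * Td)
    (m : ℕ) (W : Matrix (Fin n ⊕ Fin n) (Fin m) ℝ) (hW : IsExploration α₁ α₂ Td W) :
    Td = Matrix.fromBlocks (Matrix.diagonal γ) (-1) 1 (Matrix.diagonal γ) ∧
    (∃ (σ₁ σ₂ : Fin n → ℝ) (V : Matrix (Fin m) (Fin m) ℝ), IsSVD W 1 σ₁ σ₂ V) ∧
    (∀ (σ₁ σ₂ : Fin n → ℝ) (V : Matrix (Fin m) (Fin m) ℝ), IsSVD W 1 σ₁ σ₂ V →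
      ∀ l, 0 < σ₁ l ∧ σ₁ l = σ₂ l ∧ γ l = (α₂ - 1 / 2 * (α₁ + α₂) ^ 2) * σ₁ l ^ 2) := by
  -- The upper right blocks of `Td Tdᵀ` and `Tdᵀ Td` are `diag(γ - γ')` and `diag(γ' - γ)`.
  obtain rfl : γ = γ' := by
    rw [hTd, Matrix.fromBlocks_transpose, Matrix.fromBlocks_multiply, Matrix.fromBlocks_multiply,
      Matrix.fromBlocks_inj] at hN
    ext l
    have := congrFun (congrFun hN.2.1 l) l
    simp at this
    linarith
  refine ⟨hTd, ?_⟩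
  have hadd : Td + Td.transpose = Matrix.diagonal fun k => 2 * Sum.elim γ γ k := by
    rw [hTd, fromBlocks_one_eq_pairBlock, pairBlock_add_transpose]
  refine hW.isSVD_of_diagonal hα 1 (by simp) γ (by simpa using hadd) fun l => ?_
  have h1 := congrFun (congrFun hadd (Sum.inl l)) (Sum.inl l)
  rw [hW.add_transpose, Matrix.smul_apply, Matrix.diagonal_apply_eq, Sum.elim_inl, smul_eq_mul,
    Matrix.mul_apply] at h1
  simp only [Matrix.transpose_apply] at h1
  -- This replaces the definiteness hypothesis: if row `l` of `W` were zero, column `l` of `T(W)`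
  -- would vanish, but the block `I` puts a 1 there.
  have hS : 0 < ∑ j, W (Sum.inl l) j * W (Sum.inl l) j := by
    refine lt_of_le_of_ne (Finset.sum_nonneg fun j _ => mul_self_nonneg _) fun h => ?_
    have hrow : ∀ j, W (Sum.inl l) j = 0 := fun j => mul_self_eq_zero.1
      ((Finset.sum_eq_zero_iff_of_nonneg fun j _ => mul_self_nonneg _).1 h.symm j
        (Finset.mem_univ j))
    have hent : Td (Sum.inr l) (Sum.inl l) = 1 := by simp [hTd]
    rw [← hW.2, explorationT_eq] at hent
    simp [Matrix.mul_apply, hrow] at hent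
  have : (2 * α₂ - (α₁ + α₂) ^ 2) * γ l =
      (2 * α₂ - (α₁ + α₂) ^ 2) ^ 2 * (∑ j, W (Sum.inl l) j * W (Sum.inl l) j) / 2 := by
    linear_combination (-(2 * α₂ - (α₁ + α₂) ^ 2) / 2) * h1
  rw [this]
  positivity

theorem exists_isExploration_fromBlocks (n : ℕ) (α₁ α₂ : ℝ) (hα : α₁ + α₂ ≠ 0) (σ γ : Fin n → ℝ)
    (hσ : ∀ l, 0 < σ l) (hγ : ∀ l, γ l = (α₂ - 1 / 2 * (α₁ + α₂) ^ 2) * σ l ^ 2) :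
    ∃ (m : ℕ) (W : Matrix (Fin n ⊕ Fin n) (Fin m) ℝ) (V : Matrix (Fin m) (Fin m) ℝ),
      2 * n + 1 ≤ m ∧
      IsExploration α₁ α₂
        (Matrix.fromBlocks (Matrix.diagonal γ) (-1) 1 (Matrix.diagonal γ)) W ∧
      IsSVD W 1 σ σ V := by
  refine exists_isExploration_isSVD α₁ α₂ hα σ σ (fun _ => 1)
    (fun l => ⟨(hσ l).le, (hσ l).le⟩) (fun _ => zero_le_one)
    (fun l hl => absurd hl (mul_pos (hσ l) (hσ l)).ne') 1 _ (by simp) ?_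
  rw [fromBlocks_one_eq_pairBlock, Matrix.transpose_one, Matrix.one_mul, Matrix.mul_one]
  ext (i | i) (j | j) <;> simp [pairBlock, Matrix.diagonal_apply, hγ]

theorem corollary2 (n : ℕ) (α₁ α₂ : ℝ) (hα : α₁ + α₂ ≠ 0) :
    -- the degenerate case: all singular values are free
    (2 * α₂ - (α₁ + α₂) ^ 2 = 0 →
      ∀ Td : Matrix (Fin n ⊕ Fin n) (Fin n ⊕ Fin n) ℝ, Td.transpose = -Td →
      ∀ σ₁ σ₂ : Fin n → ℝ,
        (∀ l : Fin n, 2 * (l : ℕ) < Td.rank → 0 < σ₁ l ∧ 0 < σ₂ l) →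
        (∀ l : Fin n, Td.rank ≤ 2 * (l : ℕ) → σ₁ l = 0 ∧ σ₂ l = 0) →
        ∃ (m : ℕ) (W : Matrix (Fin n ⊕ Fin n) (Fin m) ℝ)
          (U : Matrix (Fin n ⊕ Fin n) (Fin n ⊕ Fin n) ℝ) (V : Matrix (Fin m) (Fin m) ℝ)
          (δ : Fin n → ℝ),
          Td.rank + 1 ≤ m ∧ IsExploration α₁ α₂ Td W ∧ IsSVD W U σ₁ σ₂ V ∧
          Antitone δ ∧ (∀ l, 0 ≤ δ l) ∧ U.transpose * Td * U = pairBlock 0 δ) ∧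
    (2 * α₂ - (α₁ + α₂) ^ 2 ≠ 0 →
      -- the singular values have to be equal in pairs and determine the real parts of the eigenvalues
      (∀ Td : Matrix (Fin n ⊕ Fin n) (Fin n ⊕ Fin n) ℝ,
        Td * Td.transpose = Td.transpose * Td →
        ((2 * α₂ - (α₁ + α₂) ^ 2) • (Td + Td.transpose)).PosDef →
        ∀ γ δ : Fin n → ℝ, (∀ l, 0 ≤ δ l) →
        Td.charpoly = ∏ l : Fin n,
          ((Polynomial.X - Polynomial.C (γ l)) ^ 2 + Polynomial.C (δ l) ^ 2) →
        ∀ (m : ℕ) (W : Matrix (Fin n ⊕ Fin n) (Fin m) ℝ), IsExploration α₁ α₂ Td W →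
          (∃ (U : Matrix (Fin n ⊕ Fin n) (Fin n ⊕ Fin n) ℝ) (σ₁ σ₂ : Fin n → ℝ)
            (V : Matrix (Fin m) (Fin m) ℝ),
            IsSVD W U σ₁ σ₂ V ∧ U.transpose * Td * U = pairBlock γ δ) ∧
          (∀ (U : Matrix (Fin n ⊕ Fin n) (Fin n ⊕ Fin n) ℝ) (σ₁ σ₂ : Fin n → ℝ)
            (V : Matrix (Fin m) (Fin m) ℝ),
            IsSVD W U σ₁ σ₂ V → U.transpose * Td * U = pairBlock γ δ →
            ∀ l, 0 < σ₁ l ∧ σ₁ l = σ₂ l ∧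
              γ l = (α₂ - 1 / 2 * (α₁ + α₂) ^ 2) * σ₁ l ^ 2)) ∧
      -- a normal target with diagonal diagonal blocks and off-diagonal blocks `-I`, `I`
      (∀ (γ γ' : Fin n → ℝ) (Td : Matrix (Fin n ⊕ Fin n) (Fin n ⊕ Fin n) ℝ),
        Td = Matrix.fromBlocks (Matrix.diagonal γ) (-1) 1 (Matrix.diagonal γ') →
        Td * Td.transpose = Td.transpose * Td →
        ∀ (m : ℕ) (W : Matrix (Fin n ⊕ Fin n) (Fin m) ℝ), IsExploration α₁ α₂ Td W →
          Td = Matrix.fromBlocks (Matrix.diagonal γ) (-1) 1 (Matrix.diagonal γ) ∧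
          (∃ (σ₁ σ₂ : Fin n → ℝ) (V : Matrix (Fin m) (Fin m) ℝ), IsSVD W 1 σ₁ σ₂ V) ∧
          (∀ (σ₁ σ₂ : Fin n → ℝ) (V : Matrix (Fin m) (Fin m) ℝ), IsSVD W 1 σ₁ σ₂ V →
            ∀ l, 0 < σ₁ l ∧ σ₁ l = σ₂ l ∧
              γ l = (α₂ - 1 / 2 * (α₁ + α₂) ^ 2) * σ₁ l ^ 2)) ∧
      -- every choice of positive, pairwise equal singular values occurs for that form of target
      (∀ σ γ : Fin n → ℝ, (∀ l, 0 < σ l) →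
        (∀ l, γ l = (α₂ - 1 / 2 * (α₁ + α₂) ^ 2) * σ l ^ 2) →
        ∃ (m : ℕ) (W : Matrix (Fin n ⊕ Fin n) (Fin m) ℝ) (V : Matrix (Fin m) (Fin m) ℝ),
          2 * n + 1 ≤ m ∧
          IsExploration α₁ α₂
            (Matrix.fromBlocks (Matrix.diagonal γ) (-1) 1 (Matrix.diagonal γ)) W ∧
          IsSVD W 1 σ σ V)) := by
  exact ⟨fun h0 Td hTd σ₁ σ₂ hpos hzero =>
      exists_isExploration_of_skew n α₁ α₂ hα h0 Td hTd σ₁ σ₂ hpos hzero,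
    fun h => ⟨fun Td hN hP γ δ _ hchar m W hW =>
        IsExploration.isSVD_of_normal n α₁ α₂ h Td hN hP γ δ hchar m W hW,
      fun γ γ' Td hTd hN m W hW =>
        IsExploration.isSVD_one_of_fromBlocks n α₁ α₂ h γ γ' Td hTd hN m W hW,
      fun σ γ hσ hγ => exists_isExploration_fromBlocks n α₁ α₂ hα σ γ hσ hγ⟩⟩
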